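/- Let $1\le k\le\min\{n_1,n_2\}$, let $\tau=(k_1,\dots,k_t)$ be integers $k_i\ge1$ with $k_1+\dots+k_t=k$, and let $B_1,\dots,B_N\in\mathbb C^{n_1\times n_2}$. For $A\in\mathbb C^{k\times k}$, partitioned into blocks $A_{pq}\in\mathbb C^{k_p\times k_q}$, let $\mathrm{BDiag}_\tau(A)=\mathrm{diag}(A_{11},\dots,A_{tt})$, and let $\mathrm{St}(k,n)=\{P\in\mathbb C^{n\times k}: P^{H}P=I_k\}$. For $U\in\mathbb C^{n_1\times k}$, $V\in\mathbb C^{n_2\times k}$ put $$f(U,V)=\sum_{\ell=1}^N\|\mathrm{BDiag}_\tau(U^{H}B_\ell V)\|_F^2,$$ and let $\mathscr H_1=\nabla_Uf$, $\mathscr H_2=\nabla_Vf$ be the partial Euclidean gradients with respect to $\langle X,Y\rangle=\mathrm{Re}\,\mathrm{tr}(Y^{H}X)$, i.e. $$\mathscr H_1(U,V)=2\sum_\ell B_\ell V\,\mathrm{BDiag}_\tau(V^{H}B_\ell^{H}U),\qquad \mathscr H_2(U,V)=2\sum_\ell B_\ell^{H}U\,\mathrm{BDiag}_\tau(U^{H}B_\ell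 V).$$ Let $\|\cdot\|_{\mathrm{tr}}$ be the trace (nuclear) norm, $\sigma_{\min}(X)$ the smallest of the $\min\{m,n\}$ singular values of $X\in\mathbb C^{m\times n}$, $\mathcal R(X)$ the column space of $X$, $\mathrm{sym}(X)=(X+X^{H})/2$, and $\Theta(\cdot,\cdot)$ the diagonal matrix of the canonical angles between two subspaces. An orthonormal polar factor of $A\in\mathbb C^{n\times k}$ is any $Q\in\mathrm{St}(k,n)$ with $A=Q\Lambda$ for some $\Lambda\succeq0$. Basic iteration (Gauss–Seidel type): from an initial pair $(U^{(0)},V^{(0)})$ with orthonormal columns, $U^{(i+1)}$ is an orthonormal polar factor of $\mathscr H_1(U^{(i)},V^{(i)})$, and then $V^{(i+1)}$ is an orthonormal polar factor of $\mathscr H_2(U^{(i+1)},V^{(i)})$. LOCG-accelerated iteration: let $(U^{(0)},V^{(0)})\in\mathrm{St}(k,n_1)\times\mathrm{St}(k,n_2)$. For $j=0,1,2,\dots$ write $\mathscr H_i^{(j)}=\mathscr H_i(U^{(j)},V^{(j)})$ and let $$R_1^{(j)}=\mathscr H_1^{(j)}-U^{(j)}\mathrm{sym}\big([U^{(j)}]^{H}\mathscr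 H_1^{(j)}\big),\qquad R_2^{(j)}=\mathscr H_2^{(j)}-V^{(j)}\mathrm{sym}\big([V^{(j)}]^{H}\mathscr H_2^{(j)}\big).$$ Choose $S_i\in\mathrm{St}(\hat n_i,n_i)$ with $\mathcal R(S_1)=\mathcal R([U^{(j)},R_1^{(j)},U^{(j-1)}])$ and $\mathcal R(S_2)=\mathcal R([V^{(j)},R_2^{(j)},V^{(j-1)}])$ (the last blocks being absent for $j=0$), whose first $k$ columns are $U^{(j)}$ and $V^{(j)}$, respectively. Apply the basic Gauss–Seidel iteration to the reduced matrices $S_1^{H}B_\ell S_2$, starting from the first $k$ columns of $I_{\hat n_1}$ and $I_{\hat n_2}$; let $(Z_1,Z_2)$ be its output (an iterate at which it is stopped, or a limit of a convergent subsequence of its iterates), and set $U^{(j+1)}=S_1Z_1$, $V^{(j+1)}=S_2Z_2$. Let $\{(U^{(j)},V^{(j)})\}_{j\ge0}$ be generated in this way, and suppose that there is a constant $c>0$, independent of $j$, such that for all $j\ge0$ $$f(U^{(j+1)},V^{(j+1)})-f(U^{(j)},V^{(j)})\ge c\max\Big\{\|\mathscr H_1^{(j)}\|_{\mathrm{tr}}-\mathrm{tr}\big([U^{(j)}]^{H}\mathscr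 H_1^{(j)}\big),\ \|\mathscr H_2^{(j)}\|_{\mathrm{tr}}-\mathrm{tr}\big([V^{(j)}]^{H}\mathscr H_2^{(j)}\big)\Big\}.$$ Then: (a) The sequence $\{f(U^{(j)},V^{(j)})\}_{j\ge0}$ is monotonically increasing (non-decreasing) and convergent. (b) If $(U_*,V_*)$ is an accumulation point of $\{(U^{(j)},V^{(j)})\}$, i.e. the limit of a subsequence, then $U_*\in\mathrm{St}(k,n_1)$, $V_*\in\mathrm{St}(k,n_2)$ and $$\mathscr H_1(U_*,V_*)=U_*\Lambda_{1*},\quad \Lambda_{1*}=U_*^{H}\mathscr H_1(U_*,V_*)\succeq0,\qquad \mathscr H_2(U_*,V_*)=V_*\Lambda_{2*},\quad \Lambda_{2*}=V_*^{H}\mathscr H_2(U_*,V_*)\succeq0.$$ (c) The following four series converge (a term with $\sigma_{\min}(\mathscr H_i^{(j)})=0$ is read as $0$): $$\sum_{j=0}^\infty\sigma_{\min}(\mathscr H_1^{(j)})\,\big\|\sin\Theta\big(\mathcal R(\mathscr H_1^{(j)}),\mathcal R(U^{(j)})\big)\big\|_F^2<\infty,\qquad \sum_{j=0}^\infty\sigma_{\min}(\mathscr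 H_2^{(j)})\,\big\|\sin\Theta\big(\mathcal R(\mathscr H_2^{(j)}),\mathcal R(V^{(j)})\big)\big\|_F^2<\infty,$$ $$\sum_{j=0}^\infty\sigma_{\min}(\mathscr H_1^{(j)})\,\frac{\big\|\mathscr H_1^{(j)}-U^{(j)}\big([U^{(j)}]^{H}\mathscr H_1^{(j)}\big)\big\|_F^2}{\|\mathscr H_1^{(j)}\|_F^2}<\infty,\qquad \sum_{j=0}^\infty\sigma_{\min}(\mathscr H_2^{(j)})\,\frac{\big\|\mathscr H_2^{(j)}-V^{(j)}\big([V^{(j)}]^{H}\mathscr H_2^{(j)}\big)\big\|_F^2}{\|\mathscr H_2^{(j)}\|_F^2}<\infty.$$ -/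

import Mathlib

namespace PJBSVD

noncomputable section

open scoped Matrix ComplexOrder
open Filter Topology

section Norms

attribute [local instance] Matrix.frobeniusNormedAddCommGroup

/-- The Frobenius norm of a matrix. -/
def frobNorm {𝕜 : Type*} [RCLike 𝕜] {m n : Type*} [Fintype m] [Fintype n]
    (A : Matrix m n 𝕜) : ℝ := ‖A‖

end Norms

/-- The `i`-th largest singular value of `A` (indices start at `0`). An `m × n` matrix has
`min m n` singular values, those with index `i < min m n`. -/
def singVal {m n : ℕ} (A : Matrix (Fin m) (Fin n) ℂ) (i : ℕ) : ℝ :=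
  (Matrix.toEuclideanLin A).singularValues i

/-- The trace norm (nuclear norm): the sum of the singular values. -/
def traceNorm {m n : ℕ} (A : Matrix (Fin m) (Fin n) ℂ) : ℝ :=
  ∑ i ∈ Finset.range (min m n), singVal A i

/-- The smallest singular value, i.e. the last of the `min m n` singular values. -/
def sigmaMin {m n : ℕ} (A : Matrix (Fin m) (Fin n) ℂ) : ℝ :=
  singVal A (min m n - 1)

/-- The column space of a matrix, as a subspace of the Euclidean space `ℂⁿ`. -/
def colSpace {n : ℕ} {κ : Type*} [Fintype κ] [DecidableEq κ] (A : Matrix (Fin n) κ ℂ) :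
    Submodule ℂ (EuclideanSpace ℂ (Fin n)) :=
  LinearMap.range (Matrix.toEuclideanLin A)

/-- The `i`-th canonical angle between two subspaces. The cosines of the canonical angles are the
singular values of the orthogonal projection onto `Y` restricted to `X`, whose matrix is `Qᴴ P`
whenever the columns of `P` and `Q` are orthonormal bases of `X` and `Y`. -/
def canonicalAngle {n : ℕ} (X Y : Submodule ℂ (EuclideanSpace ℂ (Fin n))) (i : ℕ) : ℝ :=
  Real.arccos (LinearMap.singularValues (𝕜 := ℂ) (E := X) (F := Y)
    (Y.orthogonalProjectionOnto.toLinearMap ∘ₗ X.subtype) i)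

/-- The diagonal matrix `sin Θ(X, Y)` of the sines of the canonical angles. -/
def sinTheta {n : ℕ} (X Y : Submodule ℂ (EuclideanSpace ℂ (Fin n))) :
    Matrix (Fin (min (Module.finrank ℂ X) (Module.finrank ℂ Y)))
      (Fin (min (Module.finrank ℂ X) (Module.finrank ℂ Y))) ℝ :=
  Matrix.diagonal fun i => Real.sin (canonicalAngle X Y i)

/-- The complex Stiefel manifold of `n × k` matrices with orthonormal columns. -/
def stiefel (n k : ℕ) : Set (Matrix (Fin n) (Fin k) ℂ) := {P | Pᴴ * P = 1}

/-- The `τ`-block diagonal part of a `k × k` matrix, for `τ = (k₁, …, k_t)` with `k₁ + ⋯ + k_t = k`;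
`τ.index i` is the number of the block that contains the index `i`. -/
def blockDiagPart {k : ℕ} (τ : Composition k) (A : Matrix (Fin k) (Fin k) ℂ) :
    Matrix (Fin k) (Fin k) ℂ :=
  Matrix.of fun i j => if τ.index i = τ.index j then A i j else 0

section Problem

variable {k n₁ n₂ N : ℕ}

/-- The objective `f(U, V) = ∑ ℓ, ‖BDiag_τ(Uᴴ B_ℓ V)‖_F²`. -/
def objective (τ : Composition k) (B : Fin N → Matrix (Fin n₁) (Fin n₂) ℂ)
    (U : Matrix (Fin n₁) (Fin k) ℂ) (V : Matrix (Fin n₂) (Fin k) ℂ) : ℝ :=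
  ∑ l, frobNorm (blockDiagPart τ (Uᴴ * B l * V)) ^ 2

/-- The partial Euclidean gradient of the objective in `U`: its `i`-th block column is
`2 ∑ ℓ, B_ℓ V_i (V_iᴴ B_ℓᴴ U_i)`. -/
def gradU (τ : Composition k) (B : Fin N → Matrix (Fin n₁) (Fin n₂) ℂ)
    (U : Matrix (Fin n₁) (Fin k) ℂ) (V : Matrix (Fin n₂) (Fin k) ℂ) :
    Matrix (Fin n₁) (Fin k) ℂ :=
  (2 : ℂ) • ∑ l, B l * V * blockDiagPart τ (Vᴴ * (B l)ᴴ * U)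

/-- The partial Euclidean gradient of the objective in `V`: its `i`-th block column is
`2 ∑ ℓ, B_ℓᴴ U_i (U_iᴴ B_ℓ V_i)`. -/
def gradV (τ : Composition k) (B : Fin N → Matrix (Fin n₁) (Fin n₂) ℂ)
    (U : Matrix (Fin n₁) (Fin k) ℂ) (V : Matrix (Fin n₂) (Fin k) ℂ) :
    Matrix (Fin n₂) (Fin k) ℂ :=
  (2 : ℂ) • ∑ l, (B l)ᴴ * U * blockDiagPart τ (Uᴴ * B l * V)

/-- `G` is the Euclidean gradient of the real-valued function `g` at `P`, for the inner product
`⟨X, Y⟩ = Re tr(Yᴴ X)`. -/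
def IsEuclideanGradient {n : ℕ} (g : Matrix (Fin n) (Fin k) ℂ → ℝ)
    (P G : Matrix (Fin n) (Fin k) ℂ) : Prop :=
  (fun E : Matrix (Fin n) (Fin k) ℂ => g (P + E) - g P - (Matrix.trace (Eᴴ * G)).re)
    =o[𝓝 0] fun E => frobNorm E

section GradientFacts

attribute [local instance] Matrix.frobeniusNormedAddCommGroup

theorem frobNorm_sq {m n : Type*} [Fintype m] [Fintype n] (A : Matrix m n ℂ) :
    frobNorm A ^ 2 = ∑ i, ∑ j, ‖A i j‖ ^ 2 := by
  have h : (0 : ℝ) ≤ ∑ i, ∑ j, ‖A i j‖ ^ 2 := by positivity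
  rw [frobNorm, Matrix.frobenius_norm_def, ← Real.sqrt_eq_rpow]
  simp only [Real.rpow_two]
  exact Real.sq_sqrt h

theorem frobNorm_blockDiagPart_le (τ : Composition k) (A : Matrix (Fin k) (Fin k) ℂ) :
    frobNorm (blockDiagPart τ A) ^ 2 ≤ frobNorm A ^ 2 := by
  rw [frobNorm_sq, frobNorm_sq]
  refine Finset.sum_le_sum fun i _ => Finset.sum_le_sum fun j _ => ?_
  by_cases h : τ.index i = τ.index j <;> simp [blockDiagPart, h]

theorem frobNorm_blockDiagPart_add (τ : Composition k) (X Y : Matrix (Fin k) (Fin k) ℂ) :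
    frobNorm (blockDiagPart τ (X + Y)) ^ 2 = frobNorm (blockDiagPart τ X) ^ 2 +
      2 * (Matrix.trace (Y * blockDiagPart τ Xᴴ)).re + frobNorm (blockDiagPart τ Y) ^ 2 := by
  simp only [frobNorm_sq, Matrix.trace, Matrix.diag, Matrix.mul_apply, Complex.re_sum,
    Finset.mul_sum, ← Finset.sum_add_distrib]
  refine Finset.sum_congr rfl fun i _ => Finset.sum_congr rfl fun j _ => ?_
  by_cases h : τ.index i = τ.index j
  · simp only [blockDiagPart, Matrix.of_apply, h, if_true, Matrix.add_apply,
      Matrix.conjTranspose_apply, ← Complex.normSq_eq_norm_sq, Complex.normSq_apply]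
    simp
    ring
  · simp [blockDiagPart, h, Ne.symm h]

theorem objective_add_left (τ : Composition k) (B : Fin N → Matrix (Fin n₁) (Fin n₂) ℂ)
    (U E : Matrix (Fin n₁) (Fin k) ℂ) (V : Matrix (Fin n₂) (Fin k) ℂ) :
    objective τ B (U + E) V = objective τ B U V + (Matrix.trace (Eᴴ * gradU τ B U V)).re +
      objective τ B E V := by
  simp only [objective, gradU, Matrix.mul_smul, Matrix.mul_sum, Matrix.trace_smul,
    Matrix.trace_sum, smul_eq_mul, Finset.mul_sum, Complex.re_sum, ← Finset.sum_add_distrib]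
  refine Finset.sum_congr rfl fun l _ => ?_
  rw [Matrix.conjTranspose_add, Matrix.add_mul, Matrix.add_mul, frobNorm_blockDiagPart_add]
  simp [Matrix.mul_assoc]

theorem objective_swap (τ : Composition k) (B : Fin N → Matrix (Fin n₁) (Fin n₂) ℂ)
    (U : Matrix (Fin n₁) (Fin k) ℂ) (V : Matrix (Fin n₂) (Fin k) ℂ) :
    objective τ (fun l => (B l)ᴴ) V U = objective τ B U V := by
  refine Finset.sum_congr rfl fun l _ => ?_
  rw [frobNorm_sq, frobNorm_sq, Finset.sum_comm]
  refine Finset.sum_congr rfl fun i _ => Finset.sum_congr rfl fun j _ => ?_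
  have h : Vᴴ * (B l)ᴴ * U = (Uᴴ * B l * V)ᴴ := by simp [Matrix.mul_assoc]
  by_cases h' : τ.index i = τ.index j
  · simp [blockDiagPart, h, h']
  · simp [blockDiagPart, h', Ne.symm h']

theorem gradU_isEuclideanGradient (τ : Composition k)
    (B : Fin N → Matrix (Fin n₁) (Fin n₂) ℂ)
    (U : Matrix (Fin n₁) (Fin k) ℂ) (V : Matrix (Fin n₂) (Fin k) ℂ) :
    IsEuclideanGradient (fun X => objective τ B X V) U (gradU τ B U V) := by
  have hO : (fun E : Matrix (Fin n₁) (Fin k) ℂ => objective τ B E V)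
      =O[𝓝 0] fun E : Matrix (Fin n₁) (Fin k) ℂ => ‖E‖ ^ 2 := by
    refine Asymptotics.IsBigO.of_bound (∑ l, ‖B l * V‖ ^ 2) (Eventually.of_forall fun E => ?_)
    have h0 : 0 ≤ objective τ B E V := Finset.sum_nonneg fun l _ => sq_nonneg _
    rw [Real.norm_of_nonneg h0, Real.norm_of_nonneg (sq_nonneg _), Finset.sum_mul]
    refine Finset.sum_le_sum fun l _ => (frobNorm_blockDiagPart_le τ _).trans ?_
    rw [← mul_pow, Matrix.mul_assoc]
    have h1 := Matrix.frobenius_norm_mul Eᴴ (B l * V)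
    rw [Matrix.frobenius_norm_conjTranspose, mul_comm] at h1
    exact pow_le_pow_left₀ (norm_nonneg _) h1 2
  have ho : (fun E : Matrix (Fin n₁) (Fin k) ℂ => ‖E‖ ^ 2) =o[𝓝 0]
      fun E : Matrix (Fin n₁) (Fin k) ℂ => frobNorm E := by
    have := Asymptotics.isLittleO_norm_pow_id (E' := Matrix (Fin n₁) (Fin k) ℂ) one_lt_two
    exact this.norm_right
  refine (hO.trans_isLittleO ho).congr_left fun E => ?_
  simp only [objective_add_left]
  ring

theorem gradV_isEuclideanGradient (τ : Composition k)
    (B : Fin N → Matrix (Fin n₁) (Fin n₂) ℂ)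
    (U : Matrix (Fin n₁) (Fin k) ℂ) (V : Matrix (Fin n₂) (Fin k) ℂ) :
    IsEuclideanGradient (fun Y => objective τ B U Y) V (gradV τ B U V) := by
  have h := gradU_isEuclideanGradient τ (fun l => (B l)ᴴ) V U
  simpa only [objective_swap, gradU, gradV, Matrix.conjTranspose_conjTranspose] using h

end GradientFacts

/-- The gap `‖H‖_tr - tr(Pᴴ H)`. For `P = U` and `H = gradU τ B U V`, or `P = V` and
`H = gradV τ B U V`, the trace is real. -/
def polarGap {n : ℕ} (P H : Matrix (Fin n) (Fin k) ℂ) : ℝ :=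
  traceNorm H - (Matrix.trace (Pᴴ * H)).re

/-- `Q` is an orthonormal polar factor of `A`: it has orthonormal columns and `A = Q Λ` with `Λ`
Hermitian positive semidefinite. -/
def IsPolarFactor {n : ℕ} (A Q : Matrix (Fin n) (Fin k) ℂ) : Prop :=
  Q ∈ stiefel n k ∧ ∃ L : Matrix (Fin k) (Fin k) ℂ, L.PosSemidef ∧ A = Q * L

/-- The KKT conditions in polar form: `H = P Λ` with `Λ = Pᴴ H ⪰ 0` for both partial gradients. -/
def PolarKKT (τ : Composition k) (B : Fin N → Matrix (Fin n₁) (Fin n₂) ℂ)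
    (U : Matrix (Fin n₁) (Fin k) ℂ) (V : Matrix (Fin n₂) (Fin k) ℂ) : Prop :=
  (U ∈ stiefel n₁ k ∧ gradU τ B U V = U * (Uᴴ * gradU τ B U V) ∧
    (Uᴴ * gradU τ B U V).PosSemidef) ∧
  (V ∈ stiefel n₂ k ∧ gradV τ B U V = V * (Vᴴ * gradV τ B U V) ∧
    (Vᴴ * gradV τ B U V).PosSemidef)

/-- The residual `H - P sym(Pᴴ H)`, where `sym(X) = (X + Xᴴ) / 2`. -/
def residual {n : ℕ} (P H : Matrix (Fin n) (Fin k) ℂ) : Matrix (Fin n) (Fin k) ℂ :=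
  H - P * ((1 / 2 : ℂ) • (Pᴴ * H + (Pᴴ * H)ᴴ))

/-- The sequence `(U j, V j)` is generated by the (unaccelerated) alternating NPDo iteration with
Gauss-Seidel-type updating for the matrices `B` from the initial pair `(U₀, V₀)`. -/
def IsNPDoGaussSeidel (τ : Composition k) (B : Fin N → Matrix (Fin n₁) (Fin n₂) ℂ)
    (U₀ : Matrix (Fin n₁) (Fin k) ℂ) (V₀ : Matrix (Fin n₂) (Fin k) ℂ)
    (U : ℕ → Matrix (Fin n₁) (Fin k) ℂ) (V : ℕ → Matrix (Fin n₂) (Fin k) ℂ) : Prop :=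
  U 0 = U₀ ∧ V 0 = V₀ ∧ U₀ ∈ stiefel n₁ k ∧ V₀ ∈ stiefel n₂ k ∧
  ∀ j, IsPolarFactor (gradU τ B (U j) (V j)) (U (j + 1)) ∧
    IsPolarFactor (gradV τ B (U (j + 1)) (V j)) (V (j + 1))

/-- `(Z₁, Z₂)` is an output of the alternating NPDo iteration with Gauss-Seidel-type updating for
`B` from `(U₀, V₀)`: an iterate at which the iteration is stopped or, if the iteration is carried
out to full convergence, a limit of (a subsequence of) its iterates. -/
def IsNPDoOutput (τ : Composition k) (B : Fin N → Matrix (Fin n₁) (Fin n₂) ℂ)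
    (U₀ : Matrix (Fin n₁) (Fin k) ℂ) (V₀ : Matrix (Fin n₂) (Fin k) ℂ)
    (Z₁ : Matrix (Fin n₁) (Fin k) ℂ) (Z₂ : Matrix (Fin n₂) (Fin k) ℂ) : Prop :=
  ∃ (U : ℕ → Matrix (Fin n₁) (Fin k) ℂ) (V : ℕ → Matrix (Fin n₂) (Fin k) ℂ),
    IsNPDoGaussSeidel τ B U₀ V₀ U V ∧
    ((∃ m, Z₁ = U m ∧ Z₂ = V m) ∨
      ∃ φ : ℕ → ℕ, StrictMono φ ∧ Tendsto (fun i => (U (φ i), V (φ i))) atTop (𝓝 (Z₁, Z₂)))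

/-- The search subspace of the LOCG acceleration at step `j`: the column space of
`[P⁽ʲ⁾, R⁽ʲ⁾, P⁽ʲ⁻¹⁾]`, where the last block is absent for `j = 0`. -/
def searchSpace {n : ℕ} (P R : ℕ → Matrix (Fin n) (Fin k) ℂ) :
    ℕ → Submodule ℂ (EuclideanSpace ℂ (Fin n))
  | 0 => colSpace (Matrix.fromCols (P 0) (R 0))
  | j + 1 => colSpace (Matrix.fromCols (Matrix.fromCols (P (j + 1)) (R (j + 1))) (P j))

/-- `S` is an orthonormal basis matrix of the subspace `W` (with `k + p` columns), the first `k`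
columns of which are `P`. -/
def IsExtendedBasis {n p : ℕ} (W : Submodule ℂ (EuclideanSpace ℂ (Fin n)))
    (P : Matrix (Fin n) (Fin k) ℂ) (S : Matrix (Fin n) (Fin (k + p)) ℂ) : Prop :=
  S ∈ stiefel n (k + p) ∧ colSpace S = W ∧ S.submatrix id (Fin.castAdd p) = P

/-- The first `k` columns of the identity matrix of order `k + p`. -/
def firstCols (k p : ℕ) : Matrix (Fin (k + p)) (Fin k) ℂ :=
  (1 : Matrix (Fin (k + p)) (Fin (k + p)) ℂ).submatrix id (Fin.castAdd p)

/-- The sequence `(U j, V j)` is generated by the LOCG-accelerated NPDo iteration in which the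
reduced problems, for the matrices `S₁ᴴ B_ℓ S₂`, are treated by the alternating NPDo iteration with
Gauss-Seidel-type updating. -/
def IsAccNPDoGaussSeidel (τ : Composition k) (B : Fin N → Matrix (Fin n₁) (Fin n₂) ℂ)
    (U : ℕ → Matrix (Fin n₁) (Fin k) ℂ) (V : ℕ → Matrix (Fin n₂) (Fin k) ℂ) : Prop :=
  U 0 ∈ stiefel n₁ k ∧ V 0 ∈ stiefel n₂ k ∧
  ∀ j, ∃ (p₁ p₂ : ℕ) (S₁ : Matrix (Fin n₁) (Fin (k + p₁)) ℂ)
    (S₂ : Matrix (Fin n₂) (Fin (k + p₂)) ℂ)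
    (Z₁ : Matrix (Fin (k + p₁)) (Fin k) ℂ) (Z₂ : Matrix (Fin (k + p₂)) (Fin k) ℂ),
    IsExtendedBasis (searchSpace U (fun i => residual (U i) (gradU τ B (U i) (V i))) j) (U j) S₁ ∧
    IsExtendedBasis (searchSpace V (fun i => residual (V i) (gradV τ B (U i) (V i))) j) (V j) S₂ ∧
    IsNPDoOutput τ (fun l => S₁ᴴ * B l * S₂) (firstCols k p₁) (firstCols k p₂) Z₁ Z₂ ∧
    U (j + 1) = S₁ * Z₁ ∧ V (j + 1) = S₂ * Z₂

end Problem

end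

end PJBSVD

open PJBSVD

/-!
Let `H` be an `n × k` matrix with `k ≤ n`. Along an orthonormal basis `v i` of right singular
vectors, `H v i = σ i • Q v i` for an orthonormal polar factor `Q` of `H`. Expanding squares,
`2 (‖H‖_tr - Re tr (Pᴴ H)) = ∑ i, σ i * ‖(Q - P) v i‖ ^ 2` for every `P` with orthonormal columns.
Hence the gap on the left is nonnegative, it is at least `σ_min(H) ‖Q - P‖_F ^ 2`, and it vanishes
only if `P` is itself a polar factor of `H`.

The objective is bounded on pairs of matrices with orthonormal columns, so sufficient increase makes
the gaps summable. Both `‖sin Θ(R(H), R(P))‖_F` (if `H` has full rank) and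
`‖H - P Pᴴ H‖_F / ‖H‖_F` are at most `‖Q - P‖_F`, which yields the four series. As the maximum of
`Re tr (Qᴴ H)` over the matrices `Q` with orthonormal columns, the trace norm is lower
semicontinuous, so the gaps of an accumulation point vanish.
-/

namespace PJBSVD

noncomputable section

open scoped Matrix ComplexOrder InnerProductSpace
open Filter Topology Module
open Matrix (toEuclideanLin trace)

section SingularValues

variable {𝕜 E F : Type*} [RCLike 𝕜] [NormedAddCommGroup E] [InnerProductSpace 𝕜 E]
  [NormedAddCommGroup F] [InnerProductSpace 𝕜 F]

theorem isPositive_of_apply_orthonormalBasis_eq_smul {ι : Type*} [Fintype ι] {T : E →ₗ[𝕜] E}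
    (b : OrthonormalBasis ι 𝕜 E) {μ : ι → ℝ} (hμ : ∀ i, 0 ≤ μ i)
    (hT : ∀ i, T (b i) = (μ i : 𝕜) • b i) : T.IsPositive := by
  classical
  have := b.toBasis.finiteDimensional_of_finite
  have hdiag : T.toMatrix b.toBasis b.toBasis = Matrix.diagonal fun i => (μ i : 𝕜) := by
    ext i j
    by_cases h : i = j <;> simp [LinearMap.toMatrix_apply, hT, h, RCLike.real_smul_eq_coe_mul]
  rw [← LinearMap.posSemidef_toMatrix_iff b, hdiag]
  exact .diagonal fun i => RCLike.ofReal_nonneg.mpr (hμ i)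

variable [FiniteDimensional 𝕜 F]

theorem exists_orthonormal_extension {ι : Type*} [Fintype ι] (hι : Fintype.card ι ≤ finrank 𝕜 F)
    {x : ι → F} {s : Set ι} (hx : Orthonormal 𝕜 (s.domRestrict x)) :
    ∃ w : ι → F, Orthonormal 𝕜 w ∧ ∀ i ∈ s, w i = x i := by
  let y : ι ⊕ Fin (finrank 𝕜 F - Fintype.card ι) → F := Sum.elim x 0
  have hy : Orthonormal 𝕜 ((Sum.inl '' s).domRestrict y) := by
    refine ⟨?_, ?_⟩
    · rintro ⟨_, i, hi, rfl⟩
      exact hx.1 ⟨i, hi⟩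
    · rintro ⟨_, i, hi, rfl⟩ ⟨_, j, hj, rfl⟩ hij
      exact hx.2 (i := ⟨i, hi⟩) (j := ⟨j, hj⟩) fun h =>
        hij (Subtype.ext (congrArg (Sum.inl ·.val) h))
  obtain ⟨b, hb⟩ := hy.exists_orthonormalBasis_extension_of_card_eq (by simp; omega)
  exact ⟨b ∘ Sum.inl, b.orthonormal.comp _ Sum.inl_injective,
    fun i hi => hb _ (Set.mem_image_of_mem _ hi)⟩

variable [FiniteDimensional 𝕜 E] (T : E →ₗ[𝕜] F)

theorem inner_apply_eigenvectorBasis {k : ℕ} (hk : finrank 𝕜 E = k) (i j : Fin k) :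
    ⟪T (T.isSymmetric_adjoint_comp_self.eigenvectorBasis hk i),
      T (T.isSymmetric_adjoint_comp_self.eigenvectorBasis hk j)⟫_𝕜 =
      if i = j then (T.singularValues j : 𝕜) ^ 2 else 0 := by
  rw [← LinearMap.adjoint_inner_right, ← LinearMap.comp_apply,
    T.isSymmetric_adjoint_comp_self.apply_eigenvectorBasis hk j, inner_smul_right,
    orthonormal_iff_ite.mp (OrthonormalBasis.orthonormal _), ← T.sq_singularValues_fin hk]
  split_ifs <;> simp

theorem norm_apply_eigenvectorBasis {k : ℕ} (hk : finrank 𝕜 E = k) (i : Fin k) :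
    ‖T (T.isSymmetric_adjoint_comp_self.eigenvectorBasis hk i)‖ = T.singularValues i := by
  rw [@norm_eq_sqrt_re_inner 𝕜, inner_apply_eigenvectorBasis, if_pos rfl, ← RCLike.ofReal_pow,
    RCLike.ofReal_re, Real.sqrt_sq (T.singularValues_nonneg i)]

theorem exists_orthonormalBasis_norm_apply_eq_singularValues {k : ℕ} (hk : finrank 𝕜 E = k) :
    ∃ e : OrthonormalBasis (Fin k) 𝕜 E, ∀ i, ‖T (e i)‖ = T.singularValues i :=
  ⟨_, norm_apply_eigenvectorBasis T hk⟩

theorem exists_linearIsometry_apply_eq_singularValues_smul {k : ℕ} (hE : finrank 𝕜 E = k)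
    (hF : k ≤ finrank 𝕜 F) :
    ∃ (v : OrthonormalBasis (Fin k) 𝕜 E) (W : E →ₗᵢ[𝕜] F),
      ∀ i, T (v i) = (T.singularValues i : 𝕜) • W (v i) := by
  set v := T.isSymmetric_adjoint_comp_self.eigenvectorBasis hE with hv
  let x : Fin k → F := fun i => (T.singularValues i : 𝕜)⁻¹ • T (v i)
  have hx : Orthonormal 𝕜 (Set.domRestrict {i : Fin k | T.singularValues i ≠ 0} x) := by
    rw [orthonormal_iff_ite]
    rintro ⟨i, hi : T.singularValues i ≠ 0⟩ ⟨j, hj⟩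
    simp only [Set.domRestrict_apply, x, inner_smul_left, inner_smul_right, hv,
      inner_apply_eigenvectorBasis, Subtype.mk.injEq]
    split_ifs with hij
    · subst hij
      have : (T.singularValues i : 𝕜) ≠ 0 := by exact_mod_cast hi
      simp only [map_inv₀, RCLike.conj_ofReal]
      field_simp
    · simp
  obtain ⟨w, hw, hwx⟩ := exists_orthonormal_extension (by simpa using hF) hx
  have hconstr (i : Fin k) : v.toBasis.constr 𝕜 w (v i) = w i := by
    simpa only [v.coe_toBasis] using v.toBasis.constr_basis 𝕜 w i
  let W : E →ₗᵢ[𝕜] F := (v.toBasis.constr 𝕜 w).isometryOfOrthonormal (v := v.toBasis)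
    (by rw [v.coe_toBasis]; exact v.orthonormal) (by simpa [Function.comp_def, hconstr])
  refine ⟨v, W, fun i => ?_⟩
  rw [show W (v i) = w i from hconstr i]
  by_cases hi : T.singularValues i = 0
  · rw [hi, RCLike.ofReal_zero, zero_smul, ← norm_eq_zero, hv, norm_apply_eigenvectorBasis, hi]
  · have : (T.singularValues i : 𝕜) ≠ 0 := by exact_mod_cast hi
    rw [hwx i hi, smul_inv_smul₀ this]

theorem sum_norm_sq_apply_eq_re_trace {ι : Type*} [Fintype ι] (b : OrthonormalBasis ι 𝕜 E) :
    ∑ i, ‖T (b i)‖ ^ 2 = RCLike.re (LinearMap.trace 𝕜 E (T.adjoint ∘ₗ T)) := by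
  simp only [LinearMap.trace_eq_sum_inner _ b, LinearMap.comp_apply, LinearMap.adjoint_inner_right,
    inner_self_eq_norm_sq_to_K, map_sum, ← RCLike.ofReal_pow, RCLike.ofReal_re]

theorem sum_norm_sq_apply_eq_sum_norm_sq_apply {ι κ : Type*} [Fintype ι] [Fintype κ]
    (b : OrthonormalBasis ι 𝕜 E) (c : OrthonormalBasis κ 𝕜 E) :
    ∑ i, ‖T (b i)‖ ^ 2 = ∑ j, ‖T (c j)‖ ^ 2 := by
  rw [sum_norm_sq_apply_eq_re_trace T b, sum_norm_sq_apply_eq_re_trace T c]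

end SingularValues

theorem norm_sub_starProjection_le {𝕜 E : Type*} [RCLike 𝕜] [NormedAddCommGroup E]
    [InnerProductSpace 𝕜 E] {Y : Submodule 𝕜 E} [Y.HasOrthogonalProjection] (x : E) {y : E}
    (hy : y ∈ Y) : ‖x - Y.starProjection x‖ ≤ ‖x - y‖ := by
  rw [Submodule.starProjection_minimal]
  exact ciInf_le (f := fun z : Y => ‖x - z‖)
    ⟨0, Set.forall_mem_range.mpr fun _ => norm_nonneg _⟩ ⟨y, hy⟩

section FrobeniusNorm

variable {l m n : Type*} [Fintype l] [Fintype m] [Fintype n]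

theorem frobNorm_nonneg {𝕜 : Type*} [RCLike 𝕜] (A : Matrix m n 𝕜) : 0 ≤ frobNorm A := by
  let := Matrix.frobeniusNormedAddCommGroup (m := m) (n := n) (α := 𝕜)
  exact norm_nonneg A

theorem frobNorm_mul_le (A : Matrix l m ℂ) (B : Matrix m n ℂ) :
    frobNorm (A * B) ≤ frobNorm A * frobNorm B :=
  Matrix.frobenius_norm_mul A B

theorem frobNorm_conjTranspose (A : Matrix m n ℂ) : frobNorm Aᴴ = frobNorm A :=
  Matrix.frobenius_norm_conjTranspose A

theorem frobNorm_sq_eq_re_trace (A : Matrix m n ℂ) : frobNorm A ^ 2 = (trace (Aᴴ * A)).re := by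
  rw [frobNorm_sq, Finset.sum_comm]
  simp [Matrix.trace, Matrix.mul_apply, Complex.conj_mul', ← Complex.ofReal_pow]

theorem frobNorm_diagonal_sq [DecidableEq n] (d : n → ℝ) :
    frobNorm (Matrix.diagonal d) ^ 2 = ∑ i, d i ^ 2 := by
  rw [frobNorm, Matrix.frobenius_norm_diagonal, EuclideanSpace.norm_sq_eq]
  simp

end FrobeniusNorm

section Stiefel

variable {m n k : ℕ}

theorem toEuclideanLin_mul_apply {l m n : ℕ} (A : Matrix (Fin l) (Fin m) ℂ)
    (B : Matrix (Fin m) (Fin n) ℂ) (x : EuclideanSpace ℂ (Fin n)) :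
    toEuclideanLin (A * B) x = toEuclideanLin A (toEuclideanLin B x) := by
  rw [Matrix.toLpLin_mul_same, LinearMap.comp_apply]

theorem trace_conjTranspose_mul_eq_sum_inner {ι : Type*} [Fintype ι]
    (A B : Matrix (Fin n) (Fin k) ℂ) (v : OrthonormalBasis ι ℂ (EuclideanSpace ℂ (Fin k))) :
    trace (Aᴴ * B) = ∑ i, ⟪toEuclideanLin A (v i), toEuclideanLin B (v i)⟫_ℂ := by
  have htrace : trace (Aᴴ * B) = LinearMap.trace ℂ _ (toEuclideanLin (Aᴴ * B)) := by
    rw [Matrix.toEuclideanLin_eq_toLin_orthonormal, Matrix.trace_toLin_eq]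
  simp only [htrace, LinearMap.trace_eq_sum_inner _ v, toEuclideanLin_mul_apply,
    Matrix.toEuclideanLin_conjTranspose_eq_adjoint, LinearMap.adjoint_inner_right]

theorem frobNorm_sq_eq_sum_norm_sq {ι : Type*} [Fintype ι]
    (A : Matrix (Fin n) (Fin k) ℂ) (v : OrthonormalBasis ι ℂ (EuclideanSpace ℂ (Fin k))) :
    frobNorm A ^ 2 = ∑ i, ‖toEuclideanLin A (v i)‖ ^ 2 := by
  rw [frobNorm_sq_eq_re_trace, trace_conjTranspose_mul_eq_sum_inner A A v]
  simp [inner_self_eq_norm_sq_to_K, ← Complex.ofReal_pow]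

theorem mem_stiefel_iff_inner {P : Matrix (Fin n) (Fin k) ℂ} :
    P ∈ stiefel n k ↔ ∀ x y, ⟪toEuclideanLin P x, toEuclideanLin P y⟫_ℂ = ⟪x, y⟫_ℂ := by
  have hadj (x y : EuclideanSpace ℂ (Fin k)) :
      ⟪toEuclideanLin P x, toEuclideanLin P y⟫_ℂ = ⟪x, toEuclideanLin (Pᴴ * P) y⟫_ℂ := by
    rw [toEuclideanLin_mul_apply, Matrix.toEuclideanLin_conjTranspose_eq_adjoint,
      LinearMap.adjoint_inner_right]
  constructor
  · intro (hP : Pᴴ * P = 1) x y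
    rw [hadj, hP, Matrix.toLpLin_one, LinearMap.id_apply]
  · intro hP
    refine (toEuclideanLin (𝕜 := ℂ) (m := Fin k) (n := Fin k)).injective ?_
    refine LinearMap.ext fun y => ext_inner_left ℂ fun x => ?_
    rw [← hadj, hP, Matrix.toLpLin_one, LinearMap.id_apply]

/-- The isometry `x ↦ P x` given by a matrix with orthonormal columns. It makes Mathlib's theory of
linear isometries available for the elements of the Stiefel manifold. -/
def stiefelIsometry {P : Matrix (Fin n) (Fin k) ℂ} (hP : P ∈ stiefel n k) :
    EuclideanSpace ℂ (Fin k) →ₗᵢ[ℂ] EuclideanSpace ℂ (Fin n) :=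
  (toEuclideanLin P).isometryOfInner (mem_stiefel_iff_inner.mp hP)

theorem norm_toEuclideanLin_of_mem_stiefel {P : Matrix (Fin n) (Fin k) ℂ} (hP : P ∈ stiefel n k)
    (x : EuclideanSpace ℂ (Fin k)) : ‖toEuclideanLin P x‖ = ‖x‖ :=
  (stiefelIsometry hP).norm_map x

theorem le_of_mem_stiefel {P : Matrix (Fin n) (Fin k) ℂ} (hP : P ∈ stiefel n k) : k ≤ n := by
  simpa using LinearMap.finrank_le_finrank_of_injective (stiefelIsometry hP).injective

theorem mul_mem_stiefel {S : Matrix (Fin n) (Fin m) ℂ} {Z : Matrix (Fin m) (Fin k) ℂ}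
    (hS : S ∈ stiefel n m) (hZ : Z ∈ stiefel m k) : S * Z ∈ stiefel n k := by
  rw [mem_stiefel_iff_inner] at hS hZ ⊢
  simp only [toEuclideanLin_mul_apply, hS, hZ, implies_true]

theorem isClosed_stiefel (n k : ℕ) : IsClosed (stiefel n k) :=
  isClosed_eq (by fun_prop) continuous_const

theorem conjTranspose_mul_mul_of_mem_stiefel {P : Matrix (Fin n) (Fin k) ℂ} (hP : P ∈ stiefel n k)
    (X : Matrix (Fin k) (Fin m) ℂ) : Pᴴ * (P * X) = X := by
  rw [← Matrix.mul_assoc, show Pᴴ * P = 1 from hP, Matrix.one_mul]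

theorem frobNorm_mul_of_mem_stiefel {P : Matrix (Fin n) (Fin k) ℂ} (hP : P ∈ stiefel n k)
    (X : Matrix (Fin k) (Fin m) ℂ) : frobNorm (P * X) = frobNorm X := by
  rw [← sq_eq_sq₀ (frobNorm_nonneg _) (frobNorm_nonneg _), frobNorm_sq_eq_re_trace,
    frobNorm_sq_eq_re_trace, Matrix.conjTranspose_mul, Matrix.mul_assoc,
    conjTranspose_mul_mul_of_mem_stiefel hP]

theorem frobNorm_sub_mul_sq_add {P : Matrix (Fin n) (Fin k) ℂ} (hP : P ∈ stiefel n k)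
    (X : Matrix (Fin n) (Fin m) ℂ) :
    frobNorm (X - P * (Pᴴ * X)) ^ 2 + frobNorm (Pᴴ * X) ^ 2 = frobNorm X ^ 2 := by
  have hgram : (X - P * (Pᴴ * X))ᴴ * (X - P * (Pᴴ * X)) = Xᴴ * X - (Pᴴ * X)ᴴ * (Pᴴ * X) := by
    simp only [Matrix.conjTranspose_sub, Matrix.conjTranspose_mul,
      Matrix.conjTranspose_conjTranspose, Matrix.mul_sub, Matrix.sub_mul, Matrix.mul_assoc,
      conjTranspose_mul_mul_of_mem_stiefel hP]
    abel
  simp only [frobNorm_sq_eq_re_trace, hgram, Matrix.trace_sub, Complex.sub_re, sub_add_cancel]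

theorem frobNorm_sub_mul_le {P : Matrix (Fin n) (Fin k) ℂ} (hP : P ∈ stiefel n k)
    (X : Matrix (Fin n) (Fin m) ℂ) : frobNorm (X - P * (Pᴴ * X)) ≤ frobNorm X :=
  le_of_sq_le_sq (by linarith [frobNorm_sub_mul_sq_add hP X, sq_nonneg (frobNorm (Pᴴ * X))])
    (frobNorm_nonneg X)

theorem frobNorm_conjTranspose_mul_le {P : Matrix (Fin n) (Fin k) ℂ} (hP : P ∈ stiefel n k)
    (X : Matrix (Fin n) (Fin m) ℂ) : frobNorm (Pᴴ * X) ≤ frobNorm X :=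
  le_of_sq_le_sq
    (by linarith [frobNorm_sub_mul_sq_add hP X, sq_nonneg (frobNorm (X - P * (Pᴴ * X)))])
    (frobNorm_nonneg X)

theorem frobNorm_mul_sub_mul_le {P Q : Matrix (Fin n) (Fin k) ℂ} (hP : P ∈ stiefel n k)
    (hQ : Q ∈ stiefel n k) (L : Matrix (Fin k) (Fin m) ℂ) :
    frobNorm (Q * L - P * (Pᴴ * (Q * L))) ≤ frobNorm (Q - P) * frobNorm (Q * L) := by
  have hcomp : Q * L - P * (Pᴴ * (Q * L)) = ((Q - P) - P * (Pᴴ * (Q - P))) * L := by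
    simp only [Matrix.mul_sub, Matrix.sub_mul, Matrix.mul_assoc,
      conjTranspose_mul_mul_of_mem_stiefel hP]
    abel
  rw [hcomp, frobNorm_mul_of_mem_stiefel hQ]
  exact (frobNorm_mul_le _ _).trans
    (mul_le_mul_of_nonneg_right (frobNorm_sub_mul_le hP _) (frobNorm_nonneg _))

end Stiefel

section CanonicalAngles

variable {n k : ℕ}

theorem exists_orthonormalBasis_norm_sub_starProjection_eq_sin_canonicalAngle
    (X Y : Submodule ℂ (EuclideanSpace ℂ (Fin n))) :
    ∃ e : OrthonormalBasis (Fin (finrank ℂ X)) ℂ X, ∀ i,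
      ‖(e i : EuclideanSpace ℂ (Fin n)) - Y.starProjection (e i)‖ =
        Real.sin (canonicalAngle X Y i) := by
  obtain ⟨e, he⟩ := exists_orthonormalBasis_norm_apply_eq_singularValues (𝕜 := ℂ) (E := X) (F := Y)
    (Y.orthogonalProjectionOnto.toLinearMap ∘ₗ X.subtype) rfl
  refine ⟨e, fun i => ?_⟩
  have hcos : ‖Y.starProjection (e i : EuclideanSpace ℂ (Fin n))‖ =
      LinearMap.singularValues (𝕜 := ℂ) (E := X) (F := Y)
        (Y.orthogonalProjectionOnto.toLinearMap ∘ₗ X.subtype) i := he i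
  have hpyth : 1 = ‖Y.starProjection (e i : EuclideanSpace ℂ (Fin n))‖ ^ 2 +
      ‖(e i : EuclideanSpace ℂ (Fin n)) - Y.starProjection (e i)‖ ^ 2 := by
    have hnorm : ‖(e i : EuclideanSpace ℂ (Fin n))‖ = 1 := e.norm_eq_one i
    simpa [hnorm, Submodule.starProjection_orthogonal'] using
      Y.norm_sq_eq_add_norm_sq_starProjection (e i : EuclideanSpace ℂ (Fin n))
  rw [canonicalAngle, Real.sin_arccos, ← hcos, sub_eq_iff_eq_add'.mpr hpyth,
    Real.sqrt_sq (norm_nonneg _)]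

theorem frobNorm_sinTheta_sq_le {X Y : Submodule ℂ (EuclideanSpace ℂ (Fin n))}
    {ι : Type*} [Fintype ι] (b : OrthonormalBasis ι ℂ X) :
    frobNorm (sinTheta X Y) ^ 2 ≤
      ∑ i, ‖(b i : EuclideanSpace ℂ (Fin n)) - Y.starProjection (b i)‖ ^ 2 := by
  obtain ⟨e, he⟩ := exists_orthonormalBasis_norm_sub_starProjection_eq_sin_canonicalAngle X Y
  let D : X →ₗ[ℂ] EuclideanSpace ℂ (Fin n) := X.subtype - Y.starProjection.toLinearMap ∘ₗ X.subtype
  have hbasis : ∑ i, ‖(e i : EuclideanSpace ℂ (Fin n)) - Y.starProjection (e i)‖ ^ 2 =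
      ∑ i, ‖(b i : EuclideanSpace ℂ (Fin n)) - Y.starProjection (b i)‖ ^ 2 :=
    sum_norm_sq_apply_eq_sum_norm_sq_apply D e b
  calc frobNorm (sinTheta X Y) ^ 2
      = ∑ i ∈ Finset.range (min (finrank ℂ X) (finrank ℂ Y)),
          Real.sin (canonicalAngle X Y i) ^ 2 := by
        rw [sinTheta, frobNorm_diagonal_sq, Finset.sum_range]
    _ ≤ ∑ i ∈ Finset.range (finrank ℂ X), Real.sin (canonicalAngle X Y i) ^ 2 :=
        Finset.sum_le_sum_of_subset_of_nonneg
          (Finset.range_subset_range.mpr (min_le_left _ _)) fun _ _ _ => sq_nonneg _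
    _ = ∑ i, ‖(e i : EuclideanSpace ℂ (Fin n)) - Y.starProjection (e i)‖ ^ 2 := by
        simp only [Finset.sum_range, he]
    _ = ∑ i, ‖(b i : EuclideanSpace ℂ (Fin n)) - Y.starProjection (b i)‖ ^ 2 := hbasis

theorem frobNorm_sinTheta_colSpace_le {Q : Matrix (Fin n) (Fin k) ℂ} (hQ : Q ∈ stiefel n k)
    (P : Matrix (Fin n) (Fin k) ℂ) :
    frobNorm (sinTheta (colSpace Q) (colSpace P)) ≤ frobNorm (Q - P) := by
  let e := EuclideanSpace.basisFun (Fin k) ℂ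
  let b : OrthonormalBasis (Fin k) ℂ (colSpace Q) := e.map (stiefelIsometry hQ).equivRange
  have hb (i : Fin k) : (b i : EuclideanSpace ℂ (Fin n)) = toEuclideanLin Q (e i) := by
    simp only [b]
    rfl
  refine le_of_sq_le_sq ((frobNorm_sinTheta_sq_le b).trans ?_) (frobNorm_nonneg _)
  rw [frobNorm_sq_eq_sum_norm_sq _ e]
  refine Finset.sum_le_sum fun i _ => pow_le_pow_left₀ (norm_nonneg _) ?_ 2
  rw [hb, map_sub, LinearMap.sub_apply]
  exact norm_sub_starProjection_le _ (LinearMap.mem_range_self _ _)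

end CanonicalAngles

section PolarGap

variable {n k : ℕ}

theorem singVal_nonneg {m n : ℕ} (A : Matrix (Fin m) (Fin n) ℂ) (i : ℕ) : 0 ≤ singVal A i :=
  LinearMap.singularValues_nonneg _ i

theorem sigmaMin_nonneg {m n : ℕ} (A : Matrix (Fin m) (Fin n) ℂ) : 0 ≤ sigmaMin A :=
  singVal_nonneg A _

theorem sigmaMin_le_singVal {m n : ℕ} (A : Matrix (Fin m) (Fin n) ℂ) {i : ℕ} (hi : i < min m n) :
    sigmaMin A ≤ singVal A i :=
  LinearMap.singularValues_antitone _ (Nat.le_sub_one_of_lt hi)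

/-- A singular value decomposition of `H` in polar form: `v` consists of right singular vectors,
and the orthonormal polar factor `Q` maps them to left singular vectors. -/
structure IsPolarSVD (H Q : Matrix (Fin n) (Fin k) ℂ)
    (v : OrthonormalBasis (Fin k) ℂ (EuclideanSpace ℂ (Fin k))) : Prop where
  mem_stiefel : Q ∈ stiefel n k
  apply_eq (i : Fin k) : toEuclideanLin H (v i) = (singVal H i : ℂ) • toEuclideanLin Q (v i)

theorem exists_isPolarSVD (hkn : k ≤ n) (H : Matrix (Fin n) (Fin k) ℂ) :
    ∃ Q v, IsPolarSVD H Q v := by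
  obtain ⟨v, W, hW⟩ := exists_linearIsometry_apply_eq_singularValues_smul
    (toEuclideanLin H) finrank_euclideanSpace_fin (by simpa using hkn)
  refine ⟨toEuclideanLin.symm W.toLinearMap, v, mem_stiefel_iff_inner.mpr fun x y => ?_,
    fun i => ?_⟩ <;> rw [LinearEquiv.apply_symm_apply]
  · exact W.inner_map_map x y
  · exact hW i

namespace IsPolarSVD

variable {H P Q : Matrix (Fin n) (Fin k) ℂ}
  {v : OrthonormalBasis (Fin k) ℂ (EuclideanSpace ℂ (Fin k))}

theorem conjTranspose_mul_apply_eq (h : IsPolarSVD H Q v) (i : Fin k) :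
    toEuclideanLin (Qᴴ * H) (v i) = (singVal H i : ℂ) • v i := by
  rw [toEuclideanLin_mul_apply, h.apply_eq, map_smul, ← toEuclideanLin_mul_apply,
    show Qᴴ * Q = 1 from h.mem_stiefel, Matrix.toLpLin_one, LinearMap.id_apply]

theorem posSemidef_conjTranspose_mul (h : IsPolarSVD H Q v) : (Qᴴ * H).PosSemidef :=
  Matrix.isPositive_toEuclideanLin_iff.mp <|
    isPositive_of_apply_orthonormalBasis_eq_smul v (fun i => singVal_nonneg H i)
      h.conjTranspose_mul_apply_eq

theorem eq_mul_conjTranspose_mul (h : IsPolarSVD H Q v) : H = Q * (Qᴴ * H) := by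
  refine (toEuclideanLin (𝕜 := ℂ) (m := Fin n) (n := Fin k)).injective (v.toBasis.ext fun i => ?_)
  rw [v.coe_toBasis, toEuclideanLin_mul_apply, h.conjTranspose_mul_apply_eq, map_smul, h.apply_eq]

theorem two_mul_polarGap (h : IsPolarSVD H Q v) (hP : P ∈ stiefel n k) :
    2 * polarGap P H = ∑ i : Fin k, singVal H i * ‖toEuclideanLin (Q - P) (v i)‖ ^ 2 := by
  rw [polarGap, traceNorm, min_eq_right (le_of_mem_stiefel hP), Finset.sum_range,
    trace_conjTranspose_mul_eq_sum_inner P H v, Complex.re_sum, ← Finset.sum_sub_distrib,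
    Finset.mul_sum]
  refine Finset.sum_congr rfl fun i _ => ?_
  rw [map_sub, LinearMap.sub_apply, @norm_sub_sq ℂ, norm_toEuclideanLin_of_mem_stiefel hP,
    norm_toEuclideanLin_of_mem_stiefel h.mem_stiefel, v.norm_eq_one, h.apply_eq, inner_smul_right,
    Complex.re_ofReal_mul, inner_re_symm, RCLike.re_to_complex]
  ring

theorem polarGap_self (h : IsPolarSVD H Q v) : polarGap Q H = 0 := by
  simpa using h.two_mul_polarGap h.mem_stiefel

theorem sigmaMin_mul_frobNorm_sub_sq_le (h : IsPolarSVD H Q v) (hP : P ∈ stiefel n k) :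
    sigmaMin H * frobNorm (Q - P) ^ 2 ≤ 2 * polarGap P H := by
  rw [h.two_mul_polarGap hP, frobNorm_sq_eq_sum_norm_sq _ v, Finset.mul_sum]
  have hlt (i : Fin k) : (i : ℕ) < min n k := by
    rw [min_eq_right (le_of_mem_stiefel hP)]
    exact i.isLt
  exact Finset.sum_le_sum fun i _ =>
    mul_le_mul_of_nonneg_right (sigmaMin_le_singVal H (hlt i)) (sq_nonneg _)

theorem congr_of_polarGap_nonpos (h : IsPolarSVD H Q v) (hP : P ∈ stiefel n k)
    (hgap : polarGap P H ≤ 0) : IsPolarSVD H P v := by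
  refine ⟨hP, fun i => ?_⟩
  have hnonneg (i : Fin k) : 0 ≤ singVal H i * ‖toEuclideanLin (Q - P) (v i)‖ ^ 2 :=
    mul_nonneg (singVal_nonneg H i) (sq_nonneg _)
  have hsum : ∑ i : Fin k, singVal H i * ‖toEuclideanLin (Q - P) (v i)‖ ^ 2 = 0 :=
    le_antisymm (by linarith [h.two_mul_polarGap hP]) (Finset.sum_nonneg fun i _ => hnonneg i)
  have hterm : singVal H i * ‖toEuclideanLin (Q - P) (v i)‖ ^ 2 = 0 :=
    (Finset.sum_eq_zero_iff_of_nonneg fun i _ => hnonneg i).mp hsum i (Finset.mem_univ i)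
  rw [h.apply_eq]
  rcases mul_eq_zero.mp hterm with hσ | hQP
  · simp [hσ]
  · rw [sq_eq_zero_iff, norm_eq_zero, map_sub, LinearMap.sub_apply, sub_eq_zero] at hQP
    rw [hQP]

theorem colSpace_eq (h : IsPolarSVD H Q v) (hH : 0 < sigmaMin H) : colSpace H = colSpace Q := by
  have hle : colSpace H ≤ colSpace Q := by
    rintro _ ⟨x, rfl⟩
    rw [h.eq_mul_conjTranspose_mul, toEuclideanLin_mul_apply]
    exact LinearMap.mem_range_self _ _
  have hinj : Function.Injective (toEuclideanLin H) := by
    rw [LinearMap.injective_iff_forall_lt_finrank_singularValues_pos, finrank_euclideanSpace_fin]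
    exact fun i hi => hH.trans_le
      (sigmaMin_le_singVal H (lt_min (hi.trans_le (le_of_mem_stiefel h.mem_stiefel)) hi))
  refine Submodule.eq_of_le_of_finrank_le hle ?_
  rw [colSpace, colSpace, LinearMap.finrank_range_of_inj hinj]
  exact LinearMap.finrank_range_le _

end IsPolarSVD

variable {P H : Matrix (Fin n) (Fin k) ℂ}

theorem polarGap_nonneg (hP : P ∈ stiefel n k) : 0 ≤ polarGap P H := by
  obtain ⟨Q, v, h⟩ := exists_isPolarSVD (le_of_mem_stiefel hP) H
  have hsum := Finset.sum_nonneg fun i (_ : i ∈ (Finset.univ : Finset (Fin k))) =>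
    mul_nonneg (singVal_nonneg H i) (sq_nonneg ‖toEuclideanLin (Q - P) (v i)‖)
  linarith [h.two_mul_polarGap hP]

theorem re_trace_conjTranspose_mul_le_traceNorm (hP : P ∈ stiefel n k) :
    (trace (Pᴴ * H)).re ≤ traceNorm H :=
  sub_nonneg.mp (polarGap_nonneg hP)

theorem sigmaMin_mul_frobNorm_sinTheta_sq_le (hP : P ∈ stiefel n k) :
    sigmaMin H * frobNorm (sinTheta (colSpace H) (colSpace P)) ^ 2 ≤ 2 * polarGap P H := by
  rcases (sigmaMin_nonneg H).eq_or_lt with hσ | hσ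
  · rw [← hσ, zero_mul]
    exact mul_nonneg zero_le_two (polarGap_nonneg hP)
  obtain ⟨Q, v, h⟩ := exists_isPolarSVD (le_of_mem_stiefel hP) H
  refine (mul_le_mul_of_nonneg_left ?_ hσ.le).trans (h.sigmaMin_mul_frobNorm_sub_sq_le hP)
  rw [h.colSpace_eq hσ]
  exact pow_le_pow_left₀ (frobNorm_nonneg _) (frobNorm_sinTheta_colSpace_le h.mem_stiefel P) 2

theorem sigmaMin_mul_frobNorm_sub_mul_sq_div_le (hP : P ∈ stiefel n k) :
    sigmaMin H * (frobNorm (H - P * (Pᴴ * H)) ^ 2 / frobNorm H ^ 2) ≤ 2 * polarGap P H := by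
  obtain ⟨Q, v, h⟩ := exists_isPolarSVD (le_of_mem_stiefel hP) H
  have hoff : frobNorm (H - P * (Pᴴ * H)) ≤ frobNorm (Q - P) * frobNorm H := by
    have := frobNorm_mul_sub_mul_le hP h.mem_stiefel (Qᴴ * H)
    rwa [← h.eq_mul_conjTranspose_mul] at this
  refine (mul_le_mul_of_nonneg_left ?_ (sigmaMin_nonneg H)).trans
    (h.sigmaMin_mul_frobNorm_sub_sq_le hP)
  rw [← div_pow]
  exact pow_le_pow_left₀ (div_nonneg (frobNorm_nonneg _) (frobNorm_nonneg _))
    (div_le_of_le_mul₀ (frobNorm_nonneg _) (frobNorm_nonneg _) hoff) 2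

theorem tendsto_re_trace_conjTranspose_mul {ι : Type*} {l : Filter ι}
    {p h : ι → Matrix (Fin n) (Fin k) ℂ} (hp : Tendsto p l (𝓝 P)) (hh : Tendsto h l (𝓝 H)) :
    Tendsto (fun i => (trace ((p i)ᴴ * h i)).re) l (𝓝 (trace (Pᴴ * H)).re) := by
  have hcont : Continuous fun x : Matrix (Fin n) (Fin k) ℂ × Matrix (Fin n) (Fin k) ℂ =>
      (trace (x.1ᴴ * x.2)).re := by fun_prop
  simpa only [Function.comp_def] using (hcont.tendsto (P, H)).comp (hp.prodMk_nhds hh)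

theorem polarGap_nonpos_of_tendsto {ι : Type*} {l : Filter ι} [l.NeBot]
    {p h : ι → Matrix (Fin n) (Fin k) ℂ} (hkn : k ≤ n) (hp : Tendsto p l (𝓝 P))
    (hh : Tendsto h l (𝓝 H)) (hgap : Tendsto (fun i => polarGap (p i) (h i)) l (𝓝 0)) :
    polarGap P H ≤ 0 := by
  obtain ⟨Q, v, hQ⟩ := exists_isPolarSVD hkn H
  have htraceNorm : Tendsto (fun i => traceNorm (h i)) l (𝓝 (trace (Pᴴ * H)).re) := by
    simpa [polarGap] using hgap.add (tendsto_re_trace_conjTranspose_mul hp hh)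
  have hle : (trace (Qᴴ * H)).re ≤ (trace (Pᴴ * H)).re :=
    le_of_tendsto_of_tendsto' (tendsto_re_trace_conjTranspose_mul tendsto_const_nhds hh)
      htraceNorm fun i => re_trace_conjTranspose_mul_le_traceNorm hQ.mem_stiefel
  exact (sub_le_sub_left hle (traceNorm H)).trans_eq hQ.polarGap_self

theorem eq_mul_and_posSemidef_of_tendsto {ι : Type*} {l : Filter ι} [l.NeBot]
    {p h : ι → Matrix (Fin n) (Fin k) ℂ} (hmem : ∀ i, p i ∈ stiefel n k)
    (hp : Tendsto p l (𝓝 P)) (hh : Tendsto h l (𝓝 H))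
    (hgap : Tendsto (fun i => polarGap (p i) (h i)) l (𝓝 0)) :
    P ∈ stiefel n k ∧ H = P * (Pᴴ * H) ∧ (Pᴴ * H).PosSemidef := by
  have hP : P ∈ stiefel n k := (isClosed_stiefel n k).mem_of_tendsto hp (.of_forall hmem)
  have hkn := le_of_mem_stiefel hP
  obtain ⟨Q, v, hQ⟩ := exists_isPolarSVD hkn H
  have hPv := hQ.congr_of_polarGap_nonpos hP (polarGap_nonpos_of_tendsto hkn hp hh hgap)
  exact ⟨hP, hPv.eq_mul_conjTranspose_mul, hPv.posSemidef_conjTranspose_mul⟩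

theorem summable_sigmaMin_mul_frobNorm_sinTheta_sq {p h : ℕ → Matrix (Fin n) (Fin k) ℂ}
    (hmem : ∀ j, p j ∈ stiefel n k) (hgap : Summable fun j => polarGap (p j) (h j)) :
    Summable fun j =>
      sigmaMin (h j) * frobNorm (sinTheta (colSpace (h j)) (colSpace (p j))) ^ 2 :=
  .of_nonneg_of_le (fun _ => mul_nonneg (sigmaMin_nonneg _) (sq_nonneg _))
    (fun j => sigmaMin_mul_frobNorm_sinTheta_sq_le (hmem j)) (hgap.mul_left 2)

theorem summable_sigmaMin_mul_frobNorm_sub_mul_sq_div {p h : ℕ → Matrix (Fin n) (Fin k) ℂ}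
    (hmem : ∀ j, p j ∈ stiefel n k) (hgap : Summable fun j => polarGap (p j) (h j)) :
    Summable fun j =>
      sigmaMin (h j) * (frobNorm (h j - p j * ((p j)ᴴ * h j)) ^ 2 / frobNorm (h j) ^ 2) :=
  .of_nonneg_of_le
    (fun _ => mul_nonneg (sigmaMin_nonneg _) (div_nonneg (sq_nonneg _) (sq_nonneg _)))
    (fun j => sigmaMin_mul_frobNorm_sub_mul_sq_div_le (hmem j)) (hgap.mul_left 2)

end PolarGap

section Iteration

variable {k n₁ n₂ N : ℕ} {τ : Composition k} {B : Fin N → Matrix (Fin n₁) (Fin n₂) ℂ}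

theorem continuous_blockDiagPart (τ : Composition k) : Continuous (blockDiagPart τ) := by
  refine continuous_matrix fun i j => ?_
  simp only [blockDiagPart, Matrix.of_apply]
  split_ifs
  · exact continuous_id.matrix_elem i j
  · exact continuous_const

theorem continuous_gradU (τ : Composition k) (B : Fin N → Matrix (Fin n₁) (Fin n₂) ℂ) :
    Continuous fun x : Matrix (Fin n₁) (Fin k) ℂ × Matrix (Fin n₂) (Fin k) ℂ =>
      gradU τ B x.1 x.2 := by
  have := continuous_blockDiagPart τ
  unfold gradU
  fun_prop

theorem continuous_gradV (τ : Composition k) (B : Fin N → Matrix (Fin n₁) (Fin n₂) ℂ) :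
    Continuous fun x : Matrix (Fin n₁) (Fin k) ℂ × Matrix (Fin n₂) (Fin k) ℂ =>
      gradV τ B x.1 x.2 := by
  have := continuous_blockDiagPart τ
  unfold gradV
  fun_prop

theorem objective_le_sum_frobNorm_sq (τ : Composition k)
    (B : Fin N → Matrix (Fin n₁) (Fin n₂) ℂ) {U : Matrix (Fin n₁) (Fin k) ℂ}
    {V : Matrix (Fin n₂) (Fin k) ℂ} (hU : U ∈ stiefel n₁ k) (hV : V ∈ stiefel n₂ k) :
    objective τ B U V ≤ ∑ l, frobNorm (B l) ^ 2 := by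
  refine Finset.sum_le_sum fun l _ => (frobNorm_blockDiagPart_le τ _).trans ?_
  refine pow_le_pow_left₀ (frobNorm_nonneg _) ?_ 2
  calc frobNorm (Uᴴ * B l * V) = frobNorm (Uᴴ * (B l * V)) := by rw [Matrix.mul_assoc]
    _ ≤ frobNorm (B l * V) := frobNorm_conjTranspose_mul_le hU _
    _ = frobNorm (Vᴴ * (B l)ᴴ) := by rw [← Matrix.conjTranspose_mul, frobNorm_conjTranspose]
    _ ≤ frobNorm (B l)ᴴ := frobNorm_conjTranspose_mul_le hV _
    _ = frobNorm (B l) := frobNorm_conjTranspose _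

theorem IsNPDoGaussSeidel.mem_stiefel {U₀ : Matrix (Fin n₁) (Fin k) ℂ}
    {V₀ : Matrix (Fin n₂) (Fin k) ℂ} {U : ℕ → Matrix (Fin n₁) (Fin k) ℂ}
    {V : ℕ → Matrix (Fin n₂) (Fin k) ℂ} (h : IsNPDoGaussSeidel τ B U₀ V₀ U V) (j : ℕ) :
    (U j, V j) ∈ stiefel n₁ k ×ˢ stiefel n₂ k := by
  obtain ⟨rfl, rfl, hU₀, hV₀, hstep⟩ := h
  cases j with
  | zero => exact ⟨hU₀, hV₀⟩
  | succ j => exact ⟨(hstep j).1.1, (hstep j).2.1⟩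

theorem IsNPDoOutput.mem_stiefel {U₀ Z₁ : Matrix (Fin n₁) (Fin k) ℂ}
    {V₀ Z₂ : Matrix (Fin n₂) (Fin k) ℂ} (h : IsNPDoOutput τ B U₀ V₀ Z₁ Z₂) :
    (Z₁, Z₂) ∈ stiefel n₁ k ×ˢ stiefel n₂ k := by
  obtain ⟨U, V, hUV, ⟨m, rfl, rfl⟩ | ⟨φ, -, hlim⟩⟩ := h
  · exact hUV.mem_stiefel m
  · exact ((isClosed_stiefel n₁ k).prod (isClosed_stiefel n₂ k)).mem_of_tendsto hlim
      (.of_forall fun i => hUV.mem_stiefel (φ i))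

theorem IsAccNPDoGaussSeidel.mem_stiefel {U : ℕ → Matrix (Fin n₁) (Fin k) ℂ}
    {V : ℕ → Matrix (Fin n₂) (Fin k) ℂ} (h : IsAccNPDoGaussSeidel τ B U V) (j : ℕ) :
    (U j, V j) ∈ stiefel n₁ k ×ˢ stiefel n₂ k := by
  obtain ⟨hU₀, hV₀, hstep⟩ := h
  cases j with
  | zero => exact ⟨hU₀, hV₀⟩
  | succ j =>
    obtain ⟨p₁, p₂, S₁, S₂, Z₁, Z₂, hS₁, hS₂, hZ, hU, hV⟩ := hstep j
    rw [hU, hV]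
    exact ⟨mul_mem_stiefel hS₁.1 hZ.mem_stiefel.1, mul_mem_stiefel hS₂.1 hZ.mem_stiefel.2⟩

end Iteration

theorem summable_of_mul_le_sub {f g : ℕ → ℝ} {c M : ℝ} (hc : 0 < c) (hg : ∀ j, 0 ≤ g j)
    (hf : ∀ j, f j ≤ M) (h : ∀ j, c * g j ≤ f (j + 1) - f j) : Summable g := by
  refine summable_of_sum_range_le (c := (M - f 0) / c) hg fun n => ?_
  rw [le_div_iff₀ hc, mul_comm, Finset.mul_sum]
  calc ∑ i ∈ Finset.range n, c * g i ≤ ∑ i ∈ Finset.range n, (f (i + 1) - f i) :=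
        Finset.sum_le_sum fun i _ => h i
    _ = f n - f 0 := Finset.sum_range_sub f n
    _ ≤ M - f 0 := sub_le_sub_right (hf n) _

end

end PJBSVD

theorem mainTheorem5_general {k n₁ n₂ N : ℕ}
    (τ : Composition k) (B : Fin N → Matrix (Fin n₁) (Fin n₂) ℂ)
    (U : ℕ → Matrix (Fin n₁) (Fin k) ℂ) (V : ℕ → Matrix (Fin n₂) (Fin k) ℂ)
    (hU : ∀ j, U j ∈ stiefel n₁ k) (hV : ∀ j, V j ∈ stiefel n₂ k)
    (H₁ : ℕ → Matrix (Fin n₁) (Fin k) ℂ) (hH₁ : ∀ j, H₁ j = gradU τ B (U j) (V j))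
    (H₂ : ℕ → Matrix (Fin n₂) (Fin k) ℂ) (hH₂ : ∀ j, H₂ j = gradV τ B (U j) (V j))
    (c : ℝ) (hc : 0 < c)
    (hprogress : ∀ j, objective τ B (U (j + 1)) (V (j + 1)) - objective τ B (U j) (V j) ≥
      c * max (polarGap (U j) (H₁ j)) (polarGap (V j) (H₂ j))) :
    (Monotone (fun j => objective τ B (U j) (V j)) ∧
      ∃ L : ℝ, Filter.Tendsto (fun j => objective τ B (U j) (V j)) Filter.atTop (nhds L)) ∧
    (∀ (Us : Matrix (Fin n₁) (Fin k) ℂ) (Vs : Matrix (Fin n₂) (Fin k) ℂ) (φ : ℕ → ℕ),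
      StrictMono φ →
      Filter.Tendsto (fun i => (U (φ i), V (φ i))) Filter.atTop (nhds (Us, Vs)) →
      PolarKKT τ B Us Vs) ∧
    (Summable fun j =>
      sigmaMin (H₁ j) * frobNorm (sinTheta (colSpace (H₁ j)) (colSpace (U j))) ^ 2) ∧
    (Summable fun j =>
      sigmaMin (H₂ j) * frobNorm (sinTheta (colSpace (H₂ j)) (colSpace (V j))) ^ 2) ∧
    (Summable fun j =>
      sigmaMin (H₁ j) *
        (frobNorm (H₁ j - U j * ((U j).conjTranspose * H₁ j)) ^ 2 / frobNorm (H₁ j) ^ 2)) ∧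
    (Summable fun j =>
      sigmaMin (H₂ j) *
        (frobNorm (H₂ j - V j * ((V j).conjTranspose * H₂ j)) ^ 2 / frobNorm (H₂ j) ^ 2)) := by
  obtain rfl : H₁ = _ := funext hH₁
  obtain rfl : H₂ = _ := funext hH₂
  set f : ℕ → ℝ := fun j => objective τ B (U j) (V j)
  have hgapU (j) : 0 ≤ polarGap (U j) (gradU τ B (U j) (V j)) := polarGap_nonneg (hU j)
  have hgapV (j) : 0 ≤ polarGap (V j) (gradV τ B (U j) (V j)) := polarGap_nonneg (hV j)
  have hf (j) : f j ≤ ∑ l, frobNorm (B l) ^ 2 := objective_le_sum_frobNorm_sq τ B (hU j) (hV j)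
  have hmono : Monotone f := monotone_nat_of_le_succ fun j => sub_nonneg.mp <|
    (mul_nonneg hc.le ((hgapU j).trans (le_max_left _ _))).trans (hprogress j)
  have hsumU := summable_of_mul_le_sub hc hgapU hf fun j =>
    (mul_le_mul_of_nonneg_left (le_max_left _ _) hc.le).trans (hprogress j)
  have hsumV := summable_of_mul_le_sub hc hgapV hf fun j =>
    (mul_le_mul_of_nonneg_left (le_max_right _ _) hc.le).trans (hprogress j)
  refine ⟨⟨hmono, _, tendsto_atTop_ciSup hmono ⟨_, Set.forall_mem_range.mpr hf⟩⟩,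
    fun Us Vs φ hφ hlim => ⟨?_, ?_⟩,
    summable_sigmaMin_mul_frobNorm_sinTheta_sq hU hsumU,
    summable_sigmaMin_mul_frobNorm_sinTheta_sq hV hsumV,
    summable_sigmaMin_mul_frobNorm_sub_mul_sq_div hU hsumU,
    summable_sigmaMin_mul_frobNorm_sub_mul_sq_div hV hsumV⟩
  · exact eq_mul_and_posSemidef_of_tendsto (fun i => hU (φ i)) hlim.fst_nhds
      (((continuous_gradU τ B).tendsto (Us, Vs)).comp hlim)
      (hsumU.tendsto_atTop_zero.comp hφ.tendsto_atTop)
  · exact eq_mul_and_posSemidef_of_tendsto (fun i => hV (φ i)) hlim.snd_nhds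
      (((continuous_gradV τ B).tendsto (Us, Vs)).comp hlim)
      (hsumV.tendsto_atTop_zero.comp hφ.tendsto_atTop)

theorem mainTheorem5 {k n₁ n₂ N : ℕ} (hk : 1 ≤ k) (hkn : k ≤ min n₁ n₂)
    (τ : Composition k) (B : Fin N → Matrix (Fin n₁) (Fin n₂) ℂ)
    (U : ℕ → Matrix (Fin n₁) (Fin k) ℂ) (V : ℕ → Matrix (Fin n₂) (Fin k) ℂ)
    (hUV : IsAccNPDoGaussSeidel τ B U V)
    (H₁ : ℕ → Matrix (Fin n₁) (Fin k) ℂ) (hH₁ : ∀ j, H₁ j = gradU τ B (U j) (V j))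
    (H₂ : ℕ → Matrix (Fin n₂) (Fin k) ℂ) (hH₂ : ∀ j, H₂ j = gradV τ B (U j) (V j))
    (c : ℝ) (hc : 0 < c)
    (hprogress : ∀ j, objective τ B (U (j + 1)) (V (j + 1)) - objective τ B (U j) (V j) ≥
      c * max (polarGap (U j) (H₁ j)) (polarGap (V j) (H₂ j))) :
    (Monotone (fun j => objective τ B (U j) (V j)) ∧
      ∃ L : ℝ, Filter.Tendsto (fun j => objective τ B (U j) (V j)) Filter.atTop (nhds L)) ∧
    (∀ (Us : Matrix (Fin n₁) (Fin k) ℂ) (Vs : Matrix (Fin n₂) (Fin k) ℂ) (φ : ℕ → ℕ),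
      StrictMono φ →
      Filter.Tendsto (fun i => (U (φ i), V (φ i))) Filter.atTop (nhds (Us, Vs)) →
      PolarKKT τ B Us Vs) ∧
    (Summable fun j =>
      sigmaMin (H₁ j) * frobNorm (sinTheta (colSpace (H₁ j)) (colSpace (U j))) ^ 2) ∧
    (Summable fun j =>
      sigmaMin (H₂ j) * frobNorm (sinTheta (colSpace (H₂ j)) (colSpace (V j))) ^ 2) ∧
    (Summable fun j =>
      sigmaMin (H₁ j) *
        (frobNorm (H₁ j - U j * ((U j).conjTranspose * H₁ j)) ^ 2 / frobNorm (H₁ j) ^ 2)) ∧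
    (Summable fun j =>
      sigmaMin (H₂ j) *
        (frobNorm (H₂ j - V j * ((V j).conjTranspose * H₂ j)) ^ 2 / frobNorm (H₂ j) ^ 2)) := by
  exact mainTheorem5_general τ B U V (fun j => (hUV.mem_stiefel j).1)
    (fun j => (hUV.mem_stiefel j).2) H₁ hH₁ H₂ hH₂ c hc hprogress
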